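/- Let $\tau=\langle <,S;\min,\max\rangle$ with $<$ a binary and $S$ a unary relation symbol and $\min,\max$ constant symbols. For $n\ge 1$, a string $w\in\{0,1\}^n$ is regarded as the $\tau$-structure with universe $\{1,\dots,n\}$, the usual order $<$, $S=\{i : w_i=1\}$, $\min=1$ and $\max=n$. A first-order $\tau$-sentence (with equality) separates a set $\mathcal A$ of strings from a set $\mathcal B$ of strings if it is true in every string of $\mathcal A$ and false in every string of $\mathcal B$. Write $\log$ for $\log_2$. Let $k$ be a real number and let $\varepsilon>0$. (1) For every real $C$ there is a constant $D=D(k,\varepsilon,C)$ such that the following holds. Let $f,g:\mathbb N\to\mathbb N$ tend to infinity and satisfy $f(n)\le Cn^k$ and $g(n)\le Cn^k$ for all $n\ge 1$. Then for every $n\ge 1$, every set of $f(n)$ $n$-bit strings can be separated from every set of $g(n)$ other $n$-bit strings by a sentence with at most $(1+\varepsilon)\log n+D$ quantifiers. (In particular, when $C=1$ the constant depends only on $k$ and $\varepsilon$.) (2) There is a constant $D=D(k,\varepsilon)$ such that the following holds. Let $f,g:\mathbb N\to\mathbb N$ tend to infinity with $f(n)=O(n^k)$ and $g(n)=O(n^k)$.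 Then for all sufficiently large $n$ (how large may depend on $f$ and $g$), every set of $f(n)$ $n$-bit strings can be separated from every set of $g(n)$ other $n$-bit strings by a sentence with at most $(1+\varepsilon)\log n+D$ quantifiers. -/

import Mathlib

open Filter Asymptotics FirstOrder

namespace BinaryStrings

/-- The constant symbols `min` and `max` of the vocabulary of binary strings. -/
inductive Func : ℕ → Type
  | min : Func 0
  | max : Func 0

/-- The relation symbols of the vocabulary of binary strings: the unary symbol `S` and the
binary symbol `<`. -/
inductive Rel : ℕ → Type
  | S : Rel 1
  | lt : Rel 2

/-- The vocabulary `⟨<, S; min, max⟩` of binary strings. -/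
def lang : Language where
  Functions := Func
  Relations := Rel

/-- The universe of the structure that encodes the `n`-bit string `w`: the set of its `n`
positions. -/
def Universe {n : ℕ} (_w : Fin n → Bool) : Type := Fin n

/-- The structure that encodes a nonempty string `w`: `<` is the order of the positions, `S` holds
at the positions that carry the bit 1, and `min`, `max` are the first and the last position. -/
instance instStructure {n : ℕ} [NeZero n] (w : Fin n → Bool) : lang.Structure (Universe w) where
  funMap {_} s _ :=
    match s with
    | Func.min => (⟨0, Nat.pos_of_neZero n⟩ : Fin n)
    | Func.max => (⟨n - 1, Nat.sub_lt (Nat.pos_of_neZero n) Nat.one_pos⟩ : Fin n)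
  RelMap {_} s :=
    match s with
    | Rel.S => fun x => w (show Fin n from x 0) = true
    | Rel.lt => fun x => (show Fin n from x 0) < (show Fin n from x 1)

/-- The number of quantifiers in a first-order formula: the number of occurrences of quantifiers.
In Mathlib formulas are built from atoms, `⊥`, `→` and `∀`; the derived connectives `¬`, `∧`, `∨`
use each argument once and `∃` is `¬∀¬`, so this counts quantifiers in the usual sense. -/
def numQuantifiers {L : Language} {α : Type} : {m : ℕ} → L.BoundedFormula α m → ℕ
  | _, .falsum => 0
  | _, .equal _ _ => 0
  | _, .rel _ _ => 0
  | _, .imp φ ψ => numQuantifiers φ + numQuantifiers ψ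
  | _, .all φ => numQuantifiers φ + 1

/-- The sentence `φ` separates `A` from `B`: it is true in every string of `A` and false in every
string of `B`. -/
def Separates {n : ℕ} [NeZero n] (φ : lang.Sentence) (A B : Finset (Fin n → Bool)) : Prop :=
  (∀ w ∈ A, Universe w ⊨ φ) ∧ (∀ w ∈ B, ¬ Universe w ⊨ φ)

/-- Every set of `a` strings of length `n` can be separated from any set of `b` other strings of
length `n` by a sentence with at most `q` quantifiers. -/
def SeparableWith (n : ℕ) [NeZero n] (a b : ℕ) (q : ℝ) : Prop :=
  ∀ A B : Finset (Fin n → Bool), A.card = a → B.card = b → Disjoint A B →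
    ∃ φ : lang.Sentence, Separates φ A B ∧ (numQuantifiers φ : ℝ) ≤ q

end BinaryStrings

/-! Formulas with one common quantifier prefix merge for free: a choice among them that depends only
on the order and bits of the variables already quantified can be moved into the matrix
(`PrefixDef.select`).

Quantify existentially `p = 2 ^ e` distinct positions, to serve as letters. Words of `q` letters,
with `p ^ q ≥ n ^ K`, suffice to name all strings of `A`, and likewise of `B`. With `q` existential
quantifiers a string of `A` spells its name, with `q` universal ones a string of `B` does
(`ContextSep.exists_name`, `ContextSep.forall_name`). What remains is one string against one other,
always with the same prefix `∃∃∃(∀∃)ʲ`, `2j ≈ log n`: it pins down a position where they differ by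
its distances to both ends (`prefixDef_bit`).

The total is `p + 2q + 2j + 3`, where `2q ≈ 2K log n / e` is at most `ε log n` up to a constant once
`e > 2K / ε`. -/

namespace BinaryStrings

/-! ### Definability with a fixed quantifier prefix -/

/-- A predicate on a string of length `n` with `m` marked positions. -/
abbrev Pred (n m : ℕ) : Type := (Fin n → Bool) → (Fin m → Fin n) → Prop

/-- Two marked strings satisfy the same atomic formulas in `<` and `S`. -/
def SameType {n m : ℕ} (w : Fin n → Bool) (v : Fin m → Fin n) (w' : Fin n → Bool)
    (v' : Fin m → Fin n) : Prop :=
  (∀ i j, v i < v j ↔ v' i < v' j) ∧ ∀ i, w (v i) = w' (v' i)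

theorem SameType.init {n m : ℕ} {w w' : Fin n → Bool} {v v' : Fin (m + 1) → Fin n}
    (h : SameType w v w' v') : SameType w (Fin.init v) w' (Fin.init v') :=
  ⟨fun i j => h.1 i.castSucc j.castSucc, fun i => h.2 i.castSucc⟩

theorem SameType.eq_iff {n m : ℕ} {w w' : Fin n → Bool} {v v' : Fin m → Fin n}
    (h : SameType w v w' v') (i j : Fin m) : v i = v j ↔ v' i = v' j := by
  have h₁ := h.1 i j
  have h₂ := h.1 j i
  constructor <;> intro e <;> apply le_antisymm <;> rw [← not_lt] <;> simp_all

/-- `P` is definable by a prenex formula with quantifier prefix `Q`, where `true` stands for `∃` and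
`false` for `∀`; its matrix is given semantically, as a predicate that respects atomic types. -/
def PrefixDef {n : ℕ} : List Bool → {m : ℕ} → Pred n m → Prop
  | [], _, P => ∀ w v w' v', SameType w v w' v' → P w v → P w' v'
  | true :: Q, m, P => ∃ P' : Pred n (m + 1), PrefixDef Q P' ∧
      ∀ w v, P w v ↔ ∃ x, P' w (Fin.snoc v x)
  | false :: Q, m, P => ∃ P' : Pred n (m + 1), PrefixDef Q P' ∧
      ∀ w v, P w v ↔ ∀ x, P' w (Fin.snoc v x)

/-- Being definable with the prefix `Q` is preserved by a choice that depends on the atomic type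
only. -/
theorem PrefixDef.select {n : ℕ} {I : Type} {Q : List Bool} {m : ℕ}
    (κ : (Fin n → Bool) → (Fin m → Fin n) → I)
    (hκ : ∀ w v w' v', SameType w v w' v' → κ w v = κ w' v')
    {P : I → Pred n m} (hP : ∀ i, PrefixDef Q (P i)) :
    PrefixDef Q (fun w v => P (κ w v) w v) := by
  induction Q generalizing m with
  | nil =>
    intro w v w' v' h hp
    rw [← hκ w v w' v' h]
    exact hP _ w v w' v' h hp
  | cons q Q ih =>
    cases q with
    | true =>
      choose P' hP' hPP' using hP
      -- The choice ignores the new variable, so it can be postponed to the matrix.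
      refine ⟨_, ih (fun w v => κ w (Fin.init v)) (fun w v w' v' h => hκ _ _ _ _ h.init) hP', ?_⟩
      intro w v
      simp only [hPP', Fin.init_snoc]
    | false =>
      choose P' hP' hPP' using hP
      refine ⟨_, ih (fun w v => κ w (Fin.init v)) (fun w v w' v' h => hκ _ _ _ _ h.init) hP', ?_⟩
      intro w v
      simp only [hPP', Fin.init_snoc]

/-- Dummy quantifiers pad a quantifier-free condition to any prefix, the universe being nonempty. -/
theorem PrefixDef.of_invariant {n : ℕ} [NeZero n] (Q : List Bool) {m : ℕ} {P : Pred n m}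
    (hP : ∀ w v w' v', SameType w v w' v' → P w v → P w' v') : PrefixDef Q P := by
  induction Q generalizing m with
  | nil => exact hP
  | cons q Q ih =>
    have h := ih (P := fun w v => P w (Fin.init v)) fun w v w' v' h => hP _ _ _ _ h.init
    cases q <;> exact ⟨_, h, fun w v => by simp only [Fin.init_snoc, forall_const, exists_const]⟩

theorem PrefixDef.const {n : ℕ} [NeZero n] (Q : List Bool) {m : ℕ} (p : Prop) :
    PrefixDef Q (fun _ _ => p : Pred n m) :=
  .of_invariant Q fun _ _ _ _ _ h => h

theorem PrefixDef.ite {n : ℕ} {Q : List Bool} {m : ℕ} {G P P' : Pred n m}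
    (hG : ∀ w v w' v', SameType w v w' v' → (G w v ↔ G w' v')) (hP : PrefixDef Q P)
    (hP' : PrefixDef Q P') : PrefixDef Q (fun w v => (G w v ∧ P w v) ∨ (¬ G w v ∧ P' w v)) := by
  classical
  have h := PrefixDef.select (Q := Q) (fun w v => decide (G w v))
    (fun w v w' v' h => by simp only [hG w v w' v' h])
    (P := fun i => bif i then P else P') (by rintro (_ | _) <;> assumption)
  convert h using 3 with w v
  by_cases hg : G w v <;> simp [hg]

theorem PrefixDef.trichotomy {n : ℕ} {Q : List Bool} {m : ℕ} {P₁ P₂ P₃ : Pred n m} (i k : Fin m)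
    (h₁ : PrefixDef Q P₁) (h₂ : PrefixDef Q P₂) (h₃ : PrefixDef Q P₃) :
    PrefixDef Q (fun w v => (v i < v k → P₁ w v) ∧ (v i = v k → P₂ w v) ∧
      (v k < v i → P₃ w v)) := by
  have h := PrefixDef.ite (G := fun _ v => v i < v k) (fun w v w' v' h => h.1 i k) h₁
    (PrefixDef.ite (G := fun _ v => v i = v k) (fun w v w' v' h => h.eq_iff i k) h₂ h₃)
  convert h using 3 with w v
  rcases lt_trichotomy (v i) (v k) with h | h | h
  · simp [h, h.ne, h.not_gt]
  · simp [h]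
  · simp [h, h.ne', h.not_gt]

/-- A block of existential quantifiers at the front of a sentence. -/
theorem PrefixDef.exists_block {n m : ℕ} {Q : List Bool} {P : Pred n m} (hP : PrefixDef Q P) :
    PrefixDef (List.replicate m true ++ Q) (fun w _ => ∃ z, P w z : Pred n 0) := by
  induction m generalizing Q with
  | zero =>
    rw [List.replicate_zero, List.nil_append]
    convert hP using 3 with w v
    constructor
    · rintro ⟨z, hz⟩
      rwa [Subsingleton.elim v z]
    · exact fun h => ⟨v, h⟩
  | succ m ih =>
    have h : PrefixDef (true :: Q) (fun w v => ∃ x, P w (Fin.snoc v x) : Pred n m) :=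
      ⟨P, hP, fun _ _ => Iff.rfl⟩
    rw [List.replicate_succ', List.append_assoc, List.singleton_append]
    convert ih h using 3 with w v
    constructor
    · rintro ⟨z, hz⟩
      exact ⟨Fin.init z, z (Fin.last m), by rwa [Fin.snoc_init_self]⟩
    · rintro ⟨z, x, hz⟩
      exact ⟨_, hz⟩

/-! ### From prefixes to first-order formulas -/

section Formulas

theorem numQuantifiers_foldr_sup {L : Language} {α : Type} {m : ℕ}
    (l : List (L.BoundedFormula α m)) (h : ∀ φ ∈ l, numQuantifiers φ = 0) :
    numQuantifiers (l.foldr (· ⊔ ·) ⊥) = 0 := by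
  induction l with
  | nil => rfl
  | cons φ l ih =>
    have h₁ := h φ (by simp)
    have h₂ := ih fun ψ hψ => h ψ (by simp [hψ])
    change numQuantifiers φ + 0 + numQuantifiers (l.foldr (· ⊔ ·) ⊥) = 0
    omega

theorem numQuantifiers_foldr_inf {L : Language} {α : Type} {m : ℕ}
    (l : List (L.BoundedFormula α m)) (h : ∀ φ ∈ l, numQuantifiers φ = 0) :
    numQuantifiers (l.foldr (· ⊓ ·) ⊤) = 0 := by
  induction l with
  | nil => rfl
  | cons φ l ih =>
    have h₁ := h φ (by simp)
    have h₂ := ih fun ψ hψ => h ψ (by simp [hψ])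
    change numQuantifiers φ + (numQuantifiers (l.foldr (· ⊓ ·) ⊤) + 0) + 0 = 0
    omega

theorem numQuantifiers_iSup {L : Language} {α β : Type} [Finite β] {m : ℕ}
    (f : β → L.BoundedFormula α m) (h : ∀ b, numQuantifiers (f b) = 0) :
    numQuantifiers (Language.BoundedFormula.iSup f) = 0 :=
  numQuantifiers_foldr_sup _ (by simpa using h)

theorem numQuantifiers_iInf {L : Language} {α β : Type} [Finite β] {m : ℕ}
    (f : β → L.BoundedFormula α m) (h : ∀ b, numQuantifiers (f b) = 0) :
    numQuantifiers (Language.BoundedFormula.iInf f) = 0 :=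
  numQuantifiers_foldr_inf _ (by simpa using h)

/-- The formula `xᵢ < xⱼ`. -/
def ltFormula {m : ℕ} (i j : Fin m) : lang.BoundedFormula Empty m :=
  Language.Relations.boundedFormula₂ (L := lang) Rel.lt (.var (.inr i)) (.var (.inr j))

/-- The formula `S(xᵢ)`. -/
def bitFormula {m : ℕ} (i : Fin m) : lang.BoundedFormula Empty m :=
  Language.Relations.boundedFormula₁ (L := lang) Rel.S (.var (.inr i))

/-- The formula `φ` is true in the string `w` when its variables are assigned the positions `v`. -/
def Holds {n m : ℕ} [NeZero n] (φ : lang.BoundedFormula Empty m) (w : Fin n → Bool)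
    (v : Fin m → Fin n) : Prop :=
  φ.Realize (M := Universe w) default v

section Holds

variable {n m : ℕ} [NeZero n] (w : Fin n → Bool) (v : Fin m → Fin n)

theorem holds_ltFormula (i j : Fin m) : Holds (ltFormula i j) w v ↔ v i < v j :=
  Language.BoundedFormula.realize_rel₂ (M := Universe w)

theorem holds_bitFormula (i : Fin m) : Holds (bitFormula i) w v ↔ w (v i) = true :=
  Language.BoundedFormula.realize_rel₁ (M := Universe w)

theorem holds_not (φ : lang.BoundedFormula Empty m) : Holds φ.not w v ↔ ¬ Holds φ w v :=
  Language.BoundedFormula.realize_not (M := Universe w)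

theorem holds_inf (φ ψ : lang.BoundedFormula Empty m) :
    Holds (φ ⊓ ψ) w v ↔ Holds φ w v ∧ Holds ψ w v :=
  Language.BoundedFormula.realize_inf (M := Universe w)

theorem holds_iInf {β : Type} [Finite β] (f : β → lang.BoundedFormula Empty m) :
    Holds (Language.BoundedFormula.iInf f) w v ↔ ∀ b, Holds (f b) w v :=
  Language.BoundedFormula.realize_iInf (M := Universe w)

theorem holds_iSup {β : Type} [Finite β] (f : β → lang.BoundedFormula Empty m) :
    Holds (Language.BoundedFormula.iSup f) w v ↔ ∃ b, Holds (f b) w v :=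
  Language.BoundedFormula.realize_iSup (M := Universe w)

theorem holds_ex (φ : lang.BoundedFormula Empty (m + 1)) :
    Holds φ.ex w v ↔ ∃ x, Holds φ w (Fin.snoc v x) :=
  Language.BoundedFormula.realize_ex (M := Universe w)

theorem holds_all (φ : lang.BoundedFormula Empty (m + 1)) :
    Holds φ.all w v ↔ ∀ x, Holds φ w (Fin.snoc v x) :=
  Language.BoundedFormula.realize_all (M := Universe w)

end Holds

open Classical in
/-- The quantifier-free formula that describes the atomic type of a marked string. -/
noncomputable def typeFormula {n m : ℕ} (w : Fin n → Bool) (v : Fin m → Fin n) :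
    lang.BoundedFormula Empty m :=
  (Language.BoundedFormula.iInf fun p : Fin m × Fin m =>
    if v p.1 < v p.2 then ltFormula p.1 p.2 else (ltFormula p.1 p.2).not) ⊓
  Language.BoundedFormula.iInf fun i : Fin m =>
    if w (v i) = true then bitFormula i else (bitFormula i).not

theorem numQuantifiers_typeFormula {n m : ℕ} (w : Fin n → Bool) (v : Fin m → Fin n) :
    numQuantifiers (typeFormula w v) = 0 := by
  change numQuantifiers (Language.BoundedFormula.iInf _) +
    (numQuantifiers (Language.BoundedFormula.iInf _) + 0) + 0 = 0
  rw [numQuantifiers_iInf, numQuantifiers_iInf]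
  · intro i
    split_ifs <;> rfl
  · intro p
    split_ifs <;> rfl

theorem holds_typeFormula {n m : ℕ} [NeZero n] (w w' : Fin n → Bool) (v v' : Fin m → Fin n) :
    Holds (typeFormula w v) w' v' ↔ SameType w v w' v' := by
  rw [typeFormula, holds_inf, holds_iInf, holds_iInf, SameType, Prod.forall]
  refine and_congr (forall₂_congr fun i j => ?_) (forall_congr' fun i => ?_)
  · split_ifs with h
    · rw [holds_ltFormula]; simp [h]
    · rw [holds_not, holds_ltFormula]; simp [h]
  · split_ifs with h
    · rw [holds_bitFormula, h, eq_comm]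
    · rw [holds_not, holds_bitFormula]
      simp only [Bool.not_eq_true] at h ⊢
      rw [h, eq_comm]

theorem PrefixDef.exists_formula {n : ℕ} [NeZero n] {Q : List Bool} {m : ℕ} {P : Pred n m}
    (hP : PrefixDef Q P) : ∃ φ : lang.BoundedFormula Empty m, numQuantifiers φ = Q.length ∧
      ∀ (w : Fin n → Bool) (v : Fin m → Fin n), Holds φ w v ↔ P w v := by
  induction Q generalizing m with
  | nil =>
    -- For fixed `n` there are finitely many marked strings, so the matrix is the finite disjunction
    -- of the types that satisfy `P`.
    refine ⟨Language.BoundedFormula.iSup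
      fun c : {c : (Fin n → Bool) × (Fin m → Fin n) // P c.1 c.2} => typeFormula c.1.1 c.1.2,
      numQuantifiers_iSup _ fun c => numQuantifiers_typeFormula _ _, fun w v => ?_⟩
    rw [holds_iSup]
    simp only [holds_typeFormula]
    constructor
    · rintro ⟨⟨⟨w', v'⟩, hc⟩, h⟩
      exact hP _ _ _ _ h hc
    · intro h
      exact ⟨⟨(w, v), h⟩, fun _ _ => Iff.rfl, fun _ => rfl⟩
  | cons q Q ih =>
    cases q with
    | true =>
      obtain ⟨P', hP', hPP'⟩ := hP
      obtain ⟨φ, hφ, h⟩ := ih hP'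
      refine ⟨φ.ex, ?_, fun w v => ?_⟩
      · change numQuantifiers φ + 0 + 1 + 0 = _
        simp [hφ]
      · rw [hPP', holds_ex]
        exact exists_congr fun x => h w (Fin.snoc v x)
    | false =>
      obtain ⟨P', hP', hPP'⟩ := hP
      obtain ⟨φ, hφ, h⟩ := ih hP'
      refine ⟨φ.all, ?_, fun w v => ?_⟩
      · change numQuantifiers φ + 1 = _
        simp [hφ]
      · rw [hPP', holds_all]
        exact forall_congr' fun x => h w (Fin.snoc v x)

theorem PrefixDef.exists_separates {n : ℕ} [NeZero n] {Q : List Bool} {P : Pred n 0}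
    (hP : PrefixDef Q P) {A B : Finset (Fin n → Bool)} (hA : ∀ w ∈ A, ∀ v, P w v)
    (hB : ∀ w ∈ B, ∀ v, ¬ P w v) :
    ∃ φ : lang.Sentence, Separates φ A B ∧ numQuantifiers φ = Q.length := by
  obtain ⟨φ, hφ, h⟩ := hP.exists_formula
  have key (w : Fin n → Bool) : Universe w ⊨ φ ↔ P w default := by
    rw [← h w default, Holds,
      Subsingleton.elim (default : Fin 0 → Fin n) (default : Fin 0 → Universe w)]
    rfl
  exact ⟨φ, ⟨fun w hw => (key w).2 (hA w hw _), fun w hw hφ => hB w hw _ ((key w).1 hφ)⟩, hφ⟩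

end Formulas

/-! ### Measuring distances with alternating quantifiers -/

/-- The largest distance that `j` pairs `∀∃` of quantifiers can bound from below. -/
def reach : ℕ → ℕ
  | 0 => 1
  | j + 1 => 4 * reach j - 1

theorem four_pow_lt_two_mul_reach (j : ℕ) : 4 ^ j < 2 * reach j := by
  induction j with
  | zero => decide
  | succ j ih =>
    rw [reach, pow_succ]
    omega

/-- The quantifier prefix `(∀∃)ʲ`. -/
def alternation : ℕ → List Bool
  | 0 => []
  | j + 1 => false :: true :: alternation j

theorem length_alternation (j : ℕ) : (alternation j).length = 2 * j := by
  induction j with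
  | zero => rfl
  | succ j ih => simp only [alternation, List.length_cons, ih]; ring

/-- A single `∀` serves both distances, since `u` falls on one side of `z` only. The two bounds for
a side add up to `a + 1`: if both fail at `u`, the distance is at most `a - 1`. The case `u = z`
secures `x < z` when `a > 0`, so that a failing `u` exists left of `z`. -/
theorem forall_halve {n : ℕ} {x z y : Fin n} {a b : ℕ} :
    ((x : ℕ) + a ≤ z ∧ (z : ℕ) + b ≤ y) ↔ ∀ u : Fin n,
      (u < z → (x : ℕ) + (a + 1) / 2 ≤ u ∨ (u : ℕ) + (a + 2) / 2 ≤ z) ∧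
      (u = z → (x : ℕ) + min a 1 ≤ z ∧ (z : ℕ) + min b 1 ≤ y) ∧
      (z < u → (z : ℕ) + (b + 2) / 2 ≤ u ∨ (u : ℕ) + (b + 1) / 2 ≤ y) := by
  simp only [Fin.lt_def, Fin.ext_iff]
  constructor
  · rintro ⟨h₁, h₂⟩ u
    omega
  · intro h
    have hz := (h z).2.1 rfl
    constructor
    · by_contra hc
      have h₁ := (h ⟨min (x + (a + 1) / 2 - 1) (z - 1), by omega⟩).1
      simp only at h₁
      omega
    · by_contra hc
      have h₁ := (h ⟨min (z + (b + 2) / 2 - 1) y, by omega⟩).2.2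
      simp only at h₁
      omega

/-- A single `∃` serves both disjuncts: the side of `u` on which `z` lies tells which one holds, and
`z` is a midpoint there. -/
theorem exists_halve {n : ℕ} {x u y : Fin n} {a b : ℕ} :
    ((x : ℕ) + a ≤ u ∨ (u : ℕ) + b ≤ y) ↔ ∃ z : Fin n,
      (z < u → (x : ℕ) + a / 2 ≤ z ∧ (z : ℕ) + (a + 1) / 2 ≤ u) ∧
      (z = u → (a = 0 ∧ x ≤ u) ∨ (b = 0 ∧ u ≤ y)) ∧
      (u < z → (u : ℕ) + (b + 1) / 2 ≤ z ∧ (z : ℕ) + b / 2 ≤ y) := by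
  simp only [Fin.lt_def, Fin.le_def, Fin.ext_iff]
  constructor
  · rintro (h | h)
    · refine ⟨⟨x + a / 2, by omega⟩, ?_⟩
      simp only
      omega
    · refine ⟨⟨u + (b + 1) / 2, by omega⟩, ?_⟩
      simp only
      omega
  · rintro ⟨z, h⟩
    omega

/-- Lower bounds on two adjacent distances are definable by `(∀∃)ʲ`. -/
theorem prefixDef_distances {n : ℕ} [NeZero n] (j : ℕ) {m : ℕ} (x z y : Fin m) {a b : ℕ}
    (ha : a ≤ reach j) (hb : b ≤ reach j) :
    PrefixDef (alternation j) (fun _ v => (v x : ℕ) + a ≤ v z ∧ (v z : ℕ) + b ≤ v y : Pred n m) := by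
  have small {m : ℕ} (x z y : Fin m) {a b : ℕ} (ha : a ≤ 1) (hb : b ≤ 1) (Q : List Bool) :
      PrefixDef Q (fun _ v => (v x : ℕ) + a ≤ v z ∧ (v z : ℕ) + b ≤ v y : Pred n m) := by
    refine .of_invariant Q fun w v w' v' h => ?_
    have h₁ := h.1 x z
    have h₂ := h.1 z x
    have h₃ := h.1 z y
    have h₄ := h.1 y z
    simp only [Fin.lt_def] at h₁ h₂ h₃ h₄
    omega
  induction j generalizing m a b with
  | zero => exact small x z y ha hb _
  | succ j ih =>
    have disj {m : ℕ} (x u y : Fin m) {a b : ℕ} (ha : a ≤ 2 * reach j) (hb : b ≤ 2 * reach j) :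
        PrefixDef (true :: alternation j)
          (fun _ v => (v x : ℕ) + a ≤ v u ∨ (v u : ℕ) + b ≤ v y : Pred n m) := by
      have h₁ := ih x.castSucc (Fin.last m) u.castSucc (a := a / 2) (b := (a + 1) / 2)
        (by omega) (by omega)
      have h₃ := ih u.castSucc (Fin.last m) y.castSucc (a := (b + 1) / 2) (b := b / 2)
        (by omega) (by omega)
      refine ⟨_, .trichotomy (Fin.last m) u.castSucc h₁
        (.of_invariant (P := fun _ v => (a = 0 ∧ v x.castSucc ≤ v u.castSucc) ∨
          (b = 0 ∧ v u.castSucc ≤ v y.castSucc)) _ fun w v w' v' h => ?_) h₃, fun w v => ?_⟩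
      · simp only [← not_lt, h.1, imp_self]
      · simp only [Fin.snoc_castSucc, Fin.snoc_last]
        exact exists_halve
    -- `(a + 2) / 2 ≤ 2 * reach j` holds exactly when `a ≤ 4 * reach j - 1`; hence the `- 1` in
    -- `reach`.
    rw [reach] at ha hb
    have hr := (Nat.zero_le _).trans_lt (four_pow_lt_two_mul_reach j)
    have h₁ := disj x.castSucc (Fin.last m) z.castSucc (a := (a + 1) / 2) (b := (a + 2) / 2)
      (by omega) (by omega)
    have h₃ := disj z.castSucc (Fin.last m) y.castSucc (a := (b + 2) / 2) (b := (b + 1) / 2)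
      (by omega) (by omega)
    refine ⟨_, .trichotomy (Fin.last m) z.castSucc h₁
      (small x.castSucc z.castSucc y.castSucc (min_le_right a 1) (min_le_right b 1) _) h₃,
      fun w v => ?_⟩
    simp only [Fin.snoc_castSucc, Fin.snoc_last]
    exact forall_halve

/-- The string has the bit `c` at position `i`. -/
theorem prefixDef_bit {n : ℕ} [NeZero n] {j : ℕ} (hj : n ≤ reach j + 1) {m : ℕ} (i : Fin n)
    (c : Bool) :
    PrefixDef (true :: true :: true :: alternation j) (fun w _ => w i = c : Pred n m) := by
  -- The two distances sum to `n - 1`, which forces the middle position to be `i`.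
  have h₁ := prefixDef_distances (n := n) j (Fin.last m).castSucc.castSucc
    (Fin.last (m + 1)).castSucc (Fin.last (m + 2)) (a := i) (b := n - 1 - i) (by omega) (by omega)
  refine ⟨_, ⟨_, ⟨_, PrefixDef.ite (G := fun w v => w (v (Fin.last (m + 1)).castSucc) = c)
    (fun w v w' v' h => by rw [h.2]) h₁ (.const _ False), fun _ _ => Iff.rfl⟩,
    fun _ _ => Iff.rfl⟩, fun w v => ?_⟩
  simp only [Fin.snoc_castSucc, Fin.snoc_last, and_false, or_false]
  constructor
  · intro h
    exact ⟨⟨0, Nat.pos_of_neZero n⟩, i, ⟨n - 1, by have := i.2; omega⟩, h, by simp, by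
      have := i.2; simp only; omega⟩
  · rintro ⟨x, z, y, h, h₁, h₂⟩
    have : z = i := Fin.ext (by omega)
    rwa [← this]

/-! ### Brute force for short strings -/

/-- Every set of strings of length `n` is definable with `n` quantifiers. -/
theorem prefixDef_mem {n : ℕ} (A : Finset (Fin n → Bool)) :
    PrefixDef (List.replicate n true) (fun w _ => w ∈ A : Pred n 0) := by
  have h : PrefixDef [] (fun w v => StrictMono v ∧ w ∘ v ∈ A : Pred n n) := by
    rintro w v w' v' h ⟨h₁, h₂⟩
    refine ⟨fun i j hij => (h.1 i j).1 (h₁ hij), ?_⟩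
    convert h₂ using 1
    exact funext fun i => (h.2 i).symm
  rw [← List.append_nil (List.replicate n true)]
  convert h.exists_block using 3 with w
  constructor
  · exact fun hw => ⟨id, strictMono_id, hw⟩
  · rintro ⟨z, hz, hw⟩
    have : z = id := by
      have e := Subsingleton.elim (hz.orderIsoOfSurjective z
        (Finite.injective_iff_surjective.1 hz.injective)) (OrderIso.refl (Fin n))
      exact funext fun i => DFunLike.congr_fun e i
    rwa [this] at hw

theorem exists_separates_of_length {n : ℕ} [NeZero n] {A B : Finset (Fin n → Bool)}
    (h : Disjoint A B) : ∃ φ : lang.Sentence, Separates φ A B ∧ numQuantifiers φ = n := by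
  obtain ⟨φ, hφ, hn⟩ := (prefixDef_mem A).exists_separates (A := A) (B := B) (fun w hw _ => hw)
    fun w hw _ => Finset.disjoint_right.1 h hw
  exact ⟨φ, hφ, by simpa using hn⟩

/-! ### Naming strings by words over marked positions -/

/-- In every context in which the positions at the indices `r` are distinct, `A` and `B` can be
separated by a formula with prefix `Q`. -/
def ContextSep {n : ℕ} (p : ℕ) (Q : List Bool) (A B : Set (Fin n → Bool)) : Prop :=
  ∀ (m : ℕ) (r : Fin p → Fin m), ∃ P : Pred n m, PrefixDef Q P ∧
    ∀ v : Fin m → Fin n, Function.Injective (v ∘ r) → (∀ w ∈ A, P w v) ∧ ∀ w ∈ B, ¬ P w v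

theorem ContextSep.of_subsingleton {n : ℕ} [NeZero n] {p j : ℕ} (hj : n ≤ reach j + 1)
    {A B : Set (Fin n → Bool)} (hA : A.Subsingleton) (hB : B.Subsingleton) (h : Disjoint A B) :
    ContextSep p (true :: true :: true :: alternation j) A B := by
  intro m r
  rcases hA.eq_empty_or_singleton with rfl | ⟨a, rfl⟩
  · exact ⟨_, .const _ False, by simp⟩
  rcases hB.eq_empty_or_singleton with rfl | ⟨b, rfl⟩
  · exact ⟨_, .const _ True, by simp⟩
  obtain ⟨i, hi⟩ := Function.ne_iff.1 (Set.disjoint_singleton.1 h)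
  exact ⟨_, prefixDef_bit hj i (a i), fun v _ => by simpa using hi.symm⟩

open Classical in
/-- The element of the context `r` that is the last marked position, if there is one. -/
noncomputable def lastIndex {n p m : ℕ} (r : Fin p → Fin m) (v : Fin (m + 1) → Fin n) :
    Option (Fin p) :=
  if h : ∃ s, v (r s).castSucc = v (Fin.last m) then some h.choose else none

theorem lastIndex_congr {n p m : ℕ} (r : Fin p → Fin m) {w w' : Fin n → Bool}
    {v v' : Fin (m + 1) → Fin n} (h : SameType w v w' v') : lastIndex r v = lastIndex r v' := by
  simp only [lastIndex, h.eq_iff]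

theorem lastIndex_snoc {n p m : ℕ} {r : Fin p → Fin m} {v : Fin m → Fin n}
    (hv : Function.Injective (v ∘ r)) (s : Fin p) :
    lastIndex r (Fin.snoc v (v (r s)) : Fin (m + 1) → Fin n) = some s := by
  have h : ∃ t, (Fin.snoc v (v (r s)) : Fin (m + 1) → Fin n) (r t).castSucc =
      (Fin.snoc v (v (r s)) : Fin (m + 1) → Fin n) (Fin.last m) := ⟨s, by simp⟩
  rw [lastIndex, dif_pos h]
  have key (t : Fin p) (e : (Fin.snoc v (v (r s)) : Fin (m + 1) → Fin n) (r t).castSucc =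
      (Fin.snoc v (v (r s)) : Fin (m + 1) → Fin n) (Fin.last m)) : t = s := by
    simp only [Fin.snoc_castSucc, Fin.snoc_last] at e
    exact hv e
  exact congrArg some (key _ h.choose_spec)

/-- Each string of `A` picks the letter `f w`, and the letter read off selects the separator for
that class. A string of `B` fails whatever it picks: every separator rejects it, and a non-letter
gives `False`. -/
theorem ContextSep.exists_cons {n p : ℕ} [NeZero n] {Q : List Bool} {A B : Set (Fin n → Bool)}
    (f : (Fin n → Bool) → Fin p) (h : ∀ s, ContextSep p Q {w ∈ A | f w = s} B) :
    ContextSep p (true :: Q) A B := by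
  intro m r
  choose P hP hsep using fun s => h s (m + 1) (fun t => (r t).castSucc)
  refine ⟨_, ⟨_, PrefixDef.select (fun _ v => lastIndex r v)
    (fun _ _ _ _ h => lastIndex_congr r h) (P := fun o => o.elim (fun _ _ => False) P) ?_,
    fun _ _ => Iff.rfl⟩, fun v hv => ⟨fun w hw => ⟨v (r (f w)), ?_⟩, ?_⟩⟩
  · rintro (_ | s)
    exacts [.const _ _, hP s]
  · rw [lastIndex_snoc hv]
    exact (hsep (f w) _ (by simpa [Function.comp_def] using hv)).1 w ⟨hw, rfl⟩
  · rintro w hw ⟨x, hx⟩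
    cases e : lastIndex r (Fin.snoc v x : Fin (m + 1) → Fin n) with
    | none => rw [e] at hx; exact hx
    | some s =>
      rw [e] at hx
      exact (hsep s _ (by simpa [Function.comp_def] using hv)).2 w hw hx

/-- Dual to `ContextSep.exists_cons`: a non-letter gives `True`, so it cannot hurt a string of `A`.
-/
theorem ContextSep.forall_cons {n p : ℕ} [NeZero n] {Q : List Bool} {A B : Set (Fin n → Bool)}
    (f : (Fin n → Bool) → Fin p) (h : ∀ s, ContextSep p Q A {w ∈ B | f w = s}) :
    ContextSep p (false :: Q) A B := by
  intro m r
  choose P hP hsep using fun s => h s (m + 1) (fun t => (r t).castSucc)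
  refine ⟨_, ⟨_, PrefixDef.select (fun _ v => lastIndex r v)
    (fun _ _ _ _ h => lastIndex_congr r h) (P := fun o => o.elim (fun _ _ => True) P) ?_,
    fun _ _ => Iff.rfl⟩, fun v hv => ⟨fun w hw x => ?_, fun w hw hx => ?_⟩⟩
  · rintro (_ | s)
    exacts [.const _ _, hP s]
  · cases e : lastIndex r (Fin.snoc v x : Fin (m + 1) → Fin n) with
    | none => trivial
    | some s => exact (hsep s _ (by simpa [Function.comp_def] using hv)).1 w hw
  · have hx := hx (v (r (f w)))
    rw [lastIndex_snoc hv] at hx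
    exact (hsep (f w) _ (by simpa [Function.comp_def] using hv)).2 w ⟨hw, rfl⟩ hx

theorem eq_cons_iff_head_tail {α : Type} {q : ℕ} (f : Fin (q + 1) → α) (s : α) (t : Fin q → α) :
    f = Fin.cons s t ↔ f 0 = s ∧ Fin.tail f = t := by
  conv_lhs => rw [← Fin.cons_self_tail f]
  exact Fin.cons_inj

theorem ContextSep.exists_name {n p q : ℕ} [NeZero n] {Q : List Bool} {A B : Set (Fin n → Bool)}
    (f : (Fin n → Bool) → Fin q → Fin p) (h : ∀ s, ContextSep p Q {w ∈ A | f w = s} B) :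
    ContextSep p (List.replicate q true ++ Q) A B := by
  induction q generalizing A with
  | zero => simpa [Subsingleton.elim _ (Fin.elim0 : Fin 0 → Fin p)] using h Fin.elim0
  | succ q ih =>
    refine .exists_cons (fun w => f w 0) fun s => ih (fun w => Fin.tail (f w)) fun t => ?_
    convert h (Fin.cons s t) using 1
    ext w
    simp only [Set.mem_ofPred_eq, and_assoc, eq_cons_iff_head_tail]

theorem ContextSep.forall_name {n p q : ℕ} [NeZero n] {Q : List Bool} {A B : Set (Fin n → Bool)}
    (f : (Fin n → Bool) → Fin q → Fin p) (h : ∀ s, ContextSep p Q A {w ∈ B | f w = s}) :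
    ContextSep p (List.replicate q false ++ Q) A B := by
  induction q generalizing B with
  | zero => simpa [Subsingleton.elim _ (Fin.elim0 : Fin 0 → Fin p)] using h Fin.elim0
  | succ q ih =>
    refine .forall_cons (fun w => f w 0) fun s => ih (fun w => Fin.tail (f w)) fun t => ?_
    convert h (Fin.cons s t) using 1
    ext w
    simp only [Set.mem_ofPred_eq, and_assoc, eq_cons_iff_head_tail]

theorem exists_naming {n p q : ℕ} (hp : 0 < p) {A : Finset (Fin n → Bool)} (hA : A.card ≤ p ^ q) :
    ∃ f : (Fin n → Bool) → Fin q → Fin p, Set.InjOn f A := by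
  classical
  obtain ⟨e⟩ := Function.Embedding.nonempty_of_card_le (α := A) (β := Fin q → Fin p)
    (by simpa using hA)
  refine ⟨fun w => if h : w ∈ A then e ⟨w, h⟩ else fun _ => ⟨0, hp⟩, fun a ha b hb hab => ?_⟩
  rw [Finset.mem_coe] at ha hb
  simp only [ha, hb, dif_pos] at hab
  exact congrArg Subtype.val (e.injective hab)

/-! ### Counting quantifiers -/

theorem exists_separates {n p q j : ℕ} [NeZero n] (hp : 0 < p) (hpn : p ≤ n)
    (hj : n ≤ reach j + 1) {A B : Finset (Fin n → Bool)} (hA : A.card ≤ p ^ q)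
    (hB : B.card ≤ p ^ q) (h : Disjoint A B) :
    ∃ φ : lang.Sentence, Separates φ A B ∧ numQuantifiers φ = p + 2 * q + 2 * j + 3 := by
  obtain ⟨f, hf⟩ := exists_naming hp hA
  obtain ⟨g, hg⟩ := exists_naming hp hB
  have hsep : ContextSep p (List.replicate q true ++ (List.replicate q false ++
      true :: true :: true :: alternation j)) (A : Set (Fin n → Bool)) B := by
    refine .exists_name f fun s => .forall_name g fun t => .of_subsingleton hj ?_ ?_ ?_
    · exact fun a ha b hb => hf ha.1 hb.1 (ha.2.trans hb.2.symm)
    · exact fun a ha b hb => hg ha.1 hb.1 (ha.2.trans hb.2.symm)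
    · exact (Finset.disjoint_coe.2 h).mono (Set.sep_subset _ _) (Set.sep_subset _ _)
  obtain ⟨P, hP, hPsep⟩ := hsep p id
  -- The guard rejects repeated letters; `p ≤ n` supplies distinct ones for `A`.
  obtain ⟨φ, hφ, hn⟩ := (PrefixDef.ite (G := fun _ v => Function.Injective v)
    (fun w v w' v' h => by simp only [Function.Injective, h.eq_iff]) hP
    (.const _ False)).exists_block.exists_separates (A := A) (B := B)
    (fun w hw _ => ⟨Fin.castLE hpn, .inl ⟨Fin.castLE_injective hpn,
      (hPsep (Fin.castLE hpn) (Fin.castLE_injective hpn)).1 w hw⟩⟩)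
    (by
      rintro w hw _ ⟨z, ⟨hz, hz'⟩ | ⟨-, hz⟩⟩
      · exact (hPsep z hz).2 w hw hz'
      · exact hz)
  refine ⟨φ, hφ, hn.trans ?_⟩
  simp only [List.length_append, List.length_replicate, List.length_cons, length_alternation]
  ring

theorem exists_separates_of_card_le_pow (K : ℕ) {ε : ℝ} (hε : 0 < ε) :
    ∃ D : ℝ, 0 ≤ D ∧ ∀ (n : ℕ) [NeZero n] (A B : Finset (Fin n → Bool)), A.card ≤ n ^ K →
      B.card ≤ n ^ K → Disjoint A B → ∃ φ : lang.Sentence, Separates φ A B ∧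
        (numQuantifiers φ : ℝ) ≤ (1 + ε) * Real.logb 2 n + D := by
  obtain ⟨e, he⟩ := exists_nat_gt (2 * K / ε)
  have he₀ : (0 : ℝ) < e := lt_of_le_of_lt (by positivity) he
  rw [div_lt_iff₀ hε] at he
  -- With `c ≤ log n + 1`, `2q ≤ εc + 2` and `2j ≤ c + 2`, the count `2 ^ e + 2q + 2j + 3` gives
  -- exactly this constant.
  refine ⟨2 ^ e + ε + 8, by positivity, fun n _ A B hA hB h => ?_⟩
  have hn : 1 ≤ n := Nat.pos_of_neZero n
  have hℓ : 0 ≤ Real.logb 2 n := Real.logb_nonneg one_lt_two (by exact_mod_cast hn)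
  rcases lt_or_ge n (2 ^ e) with hne | hne
  · obtain ⟨φ, hφ, hq⟩ := exists_separates_of_length h
    refine ⟨φ, hφ, ?_⟩
    have : (n : ℝ) ≤ 2 ^ e := by exact_mod_cast hne.le
    rw [hq]
    nlinarith [mul_nonneg hε.le hℓ]
  · obtain ⟨c, hc, hc₁⟩ : ∃ c : ℕ, Real.logb 2 n ≤ c ∧ (c : ℝ) ≤ Real.logb 2 n + 1 :=
      ⟨_, Nat.le_ceil _, (Nat.ceil_lt_add_one hℓ).le⟩
    have hnc : n ≤ 2 ^ c := by
      have := (Real.logb_le_iff_le_rpow one_lt_two (by exact_mod_cast hn)).1 hc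
      rw [Real.rpow_natCast] at this
      exact_mod_cast this
    obtain ⟨q, hq, hq₁⟩ : ∃ q : ℕ, (K * c / e : ℝ) ≤ q ∧ (q : ℝ) ≤ K * c / e + 1 :=
      ⟨_, Nat.le_ceil _, (Nat.ceil_lt_add_one (by positivity)).le⟩
    have hKc : K * c ≤ q * e := by
      have := (div_le_iff₀ he₀).1 hq
      exact_mod_cast this
    have hpow : n ^ K ≤ (2 ^ e) ^ q := calc
      n ^ K ≤ (2 ^ c) ^ K := Nat.pow_le_pow_left hnc K
      _ = 2 ^ (K * c) := by rw [← pow_mul, mul_comm]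
      _ ≤ 2 ^ (q * e) := Nat.pow_le_pow_right two_pos hKc
      _ = (2 ^ e) ^ q := by rw [← pow_mul, mul_comm]
    have hreach : n ≤ reach ((c + 2) / 2) + 1 := by
      have h₁ := four_pow_lt_two_mul_reach ((c + 2) / 2)
      have h₂ : 2 ^ (c + 1) ≤ 4 ^ ((c + 2) / 2) := by
        rw [show 4 = 2 ^ 2 from rfl, ← pow_mul]
        exact Nat.pow_le_pow_right two_pos (by omega)
      rw [pow_succ] at h₂
      omega
    obtain ⟨φ, hφ, hφq⟩ := exists_separates (Nat.two_pow_pos e) hne hreach (hA.trans hpow)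
      (hB.trans hpow) h
    refine ⟨φ, hφ, ?_⟩
    have hle : (numQuantifiers φ : ℝ) ≤ 2 ^ e + 2 * q + (c + 2) + 3 := by
      have : numQuantifiers φ ≤ 2 ^ e + 2 * q + (c + 2) + 3 := by omega
      exact_mod_cast this
    have hKe : 2 * (K * c / e : ℝ) ≤ ε * c := by
      rw [← mul_div_assoc, div_le_iff₀ he₀]
      nlinarith [(Nat.cast_nonneg c : (0 : ℝ) ≤ c)]
    nlinarith

/-- One extra power of `n` absorbs the factor `C`, so in part (2) `D` does not depend on the implied
constants. -/
theorem mul_rpow_le_pow {C k : ℝ} {n : ℕ} (hn : 1 ≤ n) (hC : C ≤ n) :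
    C * (n : ℝ) ^ k ≤ (n : ℝ) ^ (⌈k⌉₊ + 1) := by
  have hn' : (1 : ℝ) ≤ n := by exact_mod_cast hn
  calc C * (n : ℝ) ^ k ≤ n * (n : ℝ) ^ k := by gcongr
    _ ≤ n * (n : ℝ) ^ (⌈k⌉₊ : ℝ) := by
      gcongr
      exact Nat.le_ceil k
    _ = (n : ℝ) ^ (⌈k⌉₊ + 1) := by rw [Real.rpow_natCast, pow_succ, mul_comm]

end BinaryStrings

theorem mainTheorem12 (k ε : ℝ) (hε : 0 < ε) :
    (∀ C : ℝ, ∃ D : ℝ, ∀ f g : ℕ → ℕ,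
      Tendsto f atTop atTop → Tendsto g atTop atTop →
      (∀ n : ℕ, 1 ≤ n → (f n : ℝ) ≤ C * (n : ℝ) ^ k) →
      (∀ n : ℕ, 1 ≤ n → (g n : ℝ) ≤ C * (n : ℝ) ^ k) →
      ∀ (n : ℕ) [NeZero n],
        BinaryStrings.SeparableWith n (f n) (g n) ((1 + ε) * Real.logb 2 (n : ℝ) + D)) ∧
    (∃ D : ℝ, ∀ f g : ℕ → ℕ,
      Tendsto f atTop atTop → Tendsto g atTop atTop →
      (fun n : ℕ => (f n : ℝ)) =O[atTop] (fun n : ℕ => (n : ℝ) ^ k) →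
      (fun n : ℕ => (g n : ℝ)) =O[atTop] (fun n : ℕ => (n : ℝ) ^ k) →
      ∀ᶠ n : ℕ in atTop, ∀ [NeZero n],
        BinaryStrings.SeparableWith n (f n) (g n) ((1 + ε) * Real.logb 2 (n : ℝ) + D)) := by
  obtain ⟨D, hD, hsep⟩ := BinaryStrings.exists_separates_of_card_le_pow (⌈k⌉₊ + 1) hε
  refine ⟨fun C => ⟨max D ⌈C⌉₊, fun f g _ _ hf hg n _ A B hA hB h => ?_⟩,
    D, fun f g _ _ hf hg => ?_⟩
  · have hn : 1 ≤ n := Nat.pos_of_neZero n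
    rcases lt_or_ge (n : ℝ) C with hC | hC
    · obtain ⟨φ, hφ, hq⟩ := BinaryStrings.exists_separates_of_length h
      refine ⟨φ, hφ, ?_⟩
      have hℓ : 0 ≤ Real.logb 2 n := Real.logb_nonneg one_lt_two (by exact_mod_cast hn)
      rw [hq]
      calc (n : ℝ) ≤ ⌈C⌉₊ := hC.le.trans (Nat.le_ceil C)
        _ ≤ max D ⌈C⌉₊ := le_max_right _ _
        _ ≤ (1 + ε) * Real.logb 2 n + max D ⌈C⌉₊ := le_add_of_nonneg_left (by positivity)
    · have hle := BinaryStrings.mul_rpow_le_pow (k := k) hn hC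
      obtain ⟨φ, hφ, hq⟩ := hsep n A B (by rw [hA]; exact_mod_cast (hf n hn).trans hle)
        (by rw [hB]; exact_mod_cast (hg n hn).trans hle) h
      exact ⟨φ, hφ, hq.trans (by gcongr; exact le_max_left _ _)⟩
  · obtain ⟨c, hc⟩ := hf.bound
    obtain ⟨d, hd⟩ := hg.bound
    filter_upwards [hc, hd, eventually_ge_atTop ⌈c⌉₊, eventually_ge_atTop ⌈d⌉₊]
      with n hfn hgn hcn hdn _ A B hA hB h
    have hn : 1 ≤ n := Nat.pos_of_neZero n
    have hk : (0 : ℝ) ≤ (n : ℝ) ^ k := by positivity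
    rw [Real.norm_natCast, Real.norm_of_nonneg hk] at hfn hgn
    have hf' := hfn.trans (BinaryStrings.mul_rpow_le_pow hn (Nat.ceil_le.1 hcn))
    have hg' := hgn.trans (BinaryStrings.mul_rpow_le_pow hn (Nat.ceil_le.1 hdn))
    exact hsep n A B (by rw [hA]; exact_mod_cast hf') (by rw [hB]; exact_mod_cast hg') h
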